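/- Fix $d\ge 1$. For $f\in L^1(\mathbb R^d)$ let $\widehat f(\xi)=\int f(x)e^{-2\pi i\langle x,\xi\rangle}\,dx$, extended unitarily to $L^2(\mathbb R^d)$. All functions are complex valued, and $\operatorname{supp}$ denotes the closed support. Let $a>1$, let $G$ be a finite subgroup of $O_d(\mathbb R)$ with $-I\in G$, let $J\in\mathbb Z$, and let $\psi,\phi\in L^1(\mathbb R^d)\cap L^2(\mathbb R^d)$ satisfy $$|\widehat\phi(\xi)|^2+\sum_{j=1}^\infty\sum_{M\in G}|\widehat\psi(a^{-j}M^{-1}\xi)|^2=1\quad\text{for a.e. }\xi\in\mathbb R^d .$$ Put $\Psi=\{a^{dj}\psi(a^jM^{-1}\,\cdot\,) : j\in\mathbb Z,\ j>-J,\ M\in G\}\subset L^1(\mathbb R^d)\cap L^2(\mathbb R^d)$ and, for $f\in L^2(\mathbb R^d)$ and $N\in\mathbb N$, $$W_N(f)=\sum_{(\psi_1,\dots,\psi_N)\in\Psi^N}\big\|\,|\cdots||f*\psi_1|*\psi_2|\cdots*\psi_N|\,\big\|_2^2 .$$ For $\rho\in[0,1)$ let $H^\rho=\{x\in[0,\infty)^d:\langle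 x,\nu^*\rangle\ge(1-\rho)\|x\|_2\}$ with $\nu^*=(1/\sqrt d,\dots,1/\sqrt d)$. Assume that there are $A\in O_d(\mathbb R)$, $\rho\in[0,1)$ and an integer $\kappa\ge2$ such that $$\operatorname{supp}(\widehat\psi)\subseteq A H^\rho\cap\{\xi\in\mathbb R^d: a^{-1}\le\|\xi\|_2\le a^{\kappa-1}\},$$ and set $$\alpha=\sqrt{1-\frac{4a^\kappa}{(1+a^\kappa)^2}(1-\rho)^2}.$$ A nondecreasing function $\omega:(0,\infty)\to(0,\infty)$ is called weakly $t^2$-dominated if there is $T>0$ such that $h(t)=t^2\omega(t)^{-2}$ is bounded on $(0,T)$, nondecreasing on $[T,\infty)$, and tends to $\infty$ as $t\to\infty$. For $g\in\Psi$ let $d_g=\inf_{\xi'\in\mathbb R^d}\sup_{\xi\in\operatorname{supp}\widehat g}\|\xi-\xi'\|_2$, and let $\mathcal D_\omega(\Psi)$ be the set of all $f\in L^2(\mathbb R^d)$ with $\sum_{g\in\Psi}\omega(d_g)^2\|f*g\|_2^2<\infty$. Write $W_N=O(E_N)$ if there are $C>0$ and $N_0$ with $W_N\le C E_N$ for all $N\ge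 N_0$ (here $C$ and $N_0$ may depend on $f$). Then $\alpha\in(0,1)$, and the following hold. 1. For every weakly $t^2$-dominated $\omega$ and every $f\in\mathcal D_\omega(\Psi)$, $W_N(f)=O\big(\omega(\alpha^{-N})^{-2}\big)$. 2. If $s>0$ and $f\in H^s(\mathbb R^d)$, that is, $f\in L^2(\mathbb R^d)$ and $(1+\|\cdot\|_2^2)^{s/2}\widehat f\in L^2(\mathbb R^d)$, then $W_N(f)=O\big(\alpha^{2\min\{s,1\}N}\big)$. 3. If $s>0$ and $f\in H^s_{\log}(\mathbb R^d)$, that is, $f\in L^2(\mathbb R^d)$ and $\ln^s(e+\|\cdot\|_2)\widehat f\in L^2(\mathbb R^d)$, then $W_N(f)=O(N^{-2s})$. -/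

import Mathlib

open MeasureTheory Set Filter
open scoped FourierTransform ENNReal

noncomputable section

namespace Scattering

/-- Euclidean space `ℝ^d`. -/
abbrev Rd (d : ℕ) : Type := EuclideanSpace ℝ (Fin d)

/-- The complex Hilbert space `L²(ℝ^d)` (Lebesgue measure). -/
abbrev L2 (d : ℕ) : Type := Lp (α := Rd d) ℂ 2 (volume : Measure (Rd d))

/-- The orthogonal group `O_d(ℝ)`, as the group of linear isometries of `ℝ^d`. -/
abbrev Od (d : ℕ) : Type := Rd d ≃ₗᵢ[ℝ] Rd d

variable {d : ℕ}

/-! ### The scattering propagator and the energy remainder -/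

/-- The convolution `f * ψ`, that is `x ↦ ∫ f(t) ψ(x - t) dt`. -/
def conv (f ψ : Rd d → ℂ) : Rd d → ℂ :=
  convolution f ψ (ContinuousLinearMap.mul ℂ ℂ) volume

/-- The single step propagator `U[ψ] f = |f * ψ|`. -/
def propStep (ψ f : Rd d → ℂ) : Rd d → ℂ := fun x => ((‖conv f ψ x‖ : ℝ) : ℂ)

/-- The propagator along a path, `U[(ψ₁, …, ψ_N)] f = | … |f * ψ₁| * … * ψ_N|`; it is the
identity for the empty path. -/
def prop : List (Rd d → ℂ) → (Rd d → ℂ) → (Rd d → ℂ)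
  | [], f => f
  | ψ :: p, f => prop p (propStep ψ f)

/-- The energy remainder `W_N[Ψ](f) = ∑_{p ∈ Ψ^N} ‖U[p] f‖₂²`, as an extended nonnegative real. -/
def energy (Ψ : Set (L2 d)) (N : ℕ) (f : L2 d) : ℝ≥0∞ :=
  ∑' p : Fin N → Ψ,
    (eLpNorm (prop (List.ofFn fun i => ((p i : L2 d) : Rd d → ℂ)) (f : Rd d → ℂ)) 2 volume) ^ 2

/-- `W_N ∈ O(E_N)`: there are `C > 0` and `N₀` with `W_N ≤ C E_N` for all `N ≥ N₀`. -/
def IsBigOSeq (W : ℕ → ℝ≥0∞) (E : ℕ → ℝ) : Prop :=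
  ∃ C : ℝ, 0 < C ∧ ∃ N₀ : ℕ, ∀ N : ℕ, N₀ ≤ N → W N ≤ ENNReal.ofReal (C * E N)

/-! ### Weights and weighted spaces -/

/-- `ω` restricts to a weakly `t^k`-dominated weight `(0,∞) → (0,∞)`; its values outside `(0,∞)`
are irrelevant. -/
def IsWeaklyDominated (k : ℝ) (ω : ℝ → ℝ) : Prop :=
  (∀ t : ℝ, 0 < t → 0 < ω t) ∧ MonotoneOn ω (Ioi 0) ∧
    ∃ T : ℝ, 0 < T ∧
      (∃ B : ℝ, ∀ t ∈ Ioo 0 T, t ^ k * (ω t) ^ (-2 : ℤ) ≤ B) ∧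
      MonotoneOn (fun t : ℝ => t ^ k * (ω t) ^ (-2 : ℤ)) (Ici T) ∧
      Tendsto (fun t : ℝ => t ^ k * (ω t) ^ (-2 : ℤ)) atTop atTop

/-- `d_ψ`, the infimum over centers `ξ'` of the supremum over `ξ ∈ supp ψ̂` of `‖ξ - ξ'‖`
(used for integrable `ψ` whose Fourier transform has nonempty compact support). -/
def freqRadius (ψ : Rd d → ℂ) : ℝ :=
  ⨅ ξ' : Rd d, ⨆ ξ : tsupport (𝓕 ψ), ‖(ξ : Rd d) - ξ'‖

/-- The space `D_ω(Ψ; L²)` of all `f ∈ L²` with `∑_{ψ ∈ Ψ} ω(d_ψ)² ‖f * ψ‖₂² < ∞`. -/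
def decompSpace (ω : ℝ → ℝ) (Ψ : Set (L2 d)) : Set (L2 d) :=
  {f | ∑' ψ : Ψ, ENNReal.ofReal (ω (freqRadius ((ψ : L2 d) : Rd d → ℂ)) ^ 2) *
    (eLpNorm (conv (f : Rd d → ℂ) ((ψ : L2 d) : Rd d → ℂ)) 2 volume) ^ 2 < ∞}

/-- The space `FL²_ω` of all `f ∈ L²` with `ω(‖·‖) f̂ ∈ L²`, where `f̂` is the Plancherel
transform. -/
def fourierWeighted (ω : ℝ → ℝ) : Set (L2 d) :=
  {f | MemLp (fun ξ : Rd d => ((ω ‖ξ‖ : ℝ) : ℂ) * ((𝓕 f : L2 d) : Rd d → ℂ) ξ) 2 volume}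

/-- The fractional Sobolev space `H^s(ℝ^d)`, with weight `(1 + t²)^{s/2}`. -/
def sobolev (d : ℕ) (s : ℝ) : Set (L2 d) :=
  fourierWeighted fun t => (1 + t ^ 2) ^ (s / 2)

/-- The fractional log-Sobolev space `H^s_log(ℝ^d)`, with weight `ln^s(e + t)`. -/
def logSobolev (d : ℕ) (s : ℝ) : Set (L2 d) :=
  fourierWeighted fun t => Real.log (Real.exp 1 + t) ^ s

/-! ### Wavelet-generated filters -/

/-- The pair `(ψ, φ) ∈ (L¹ ∩ L²)²` is admissible for `(a,G)`-wavelet scattering: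
`|φ̂(ξ)|² + ∑_{j ≥ 1} ∑_{M ∈ G} |ψ̂(a^{-j} M⁻¹ ξ)|² = 1` for almost every `ξ`. -/
structure IsAdmissible (a : ℝ) (G : Subgroup (Od d)) (ψ φ : Rd d → ℂ) : Prop where
  memL1_wavelet : MemLp ψ 1 volume
  memL2_wavelet : MemLp ψ 2 volume
  memL1_lowpass : MemLp φ 1 volume
  memL2_lowpass : MemLp φ 2 volume
  littlewoodPaley : ∀ᵐ ξ : Rd d, ‖𝓕 φ ξ‖ₑ ^ 2 +
    ∑' j : ℕ, ∑' M : G, ‖𝓕 ψ (a ^ (-((j : ℤ) + 1)) • ((M : Od d)⁻¹ ξ))‖ₑ ^ 2 = 1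

/-- `ψ_λ = a^{dj} ψ(a^j M⁻¹ ·)` for `λ = a^j M`. -/
def dilate (a : ℝ) (ψ : Rd d → ℂ) (j : ℤ) (M : Od d) : Rd d → ℂ :=
  fun x => ((a ^ ((d : ℤ) * j) : ℝ) : ℂ) * ψ (a ^ j • (M⁻¹ x))

/-- The filter bank `Wav(ψ,a,G,J) = {ψ_λ | λ = a^j M, j > -J, M ∈ G}`, as a set of elements
of `L²` (almost everywhere equal filters are identified). -/
def wav (ψ : Rd d → ℂ) (a : ℝ) (G : Subgroup (Od d)) (J : ℤ) : Set (L2 d) :=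
  {g | ∃ j : ℤ, -J < j ∧ ∃ M ∈ G, (g : Rd d → ℂ) =ᵐ[volume] dilate a ψ j M}

/-! ### The allowed frequency region -/

/-- The vector `ν* = (1/√d, …, 1/√d)`. -/
def nuStar (d : ℕ) : Rd d := WithLp.toLp 2 fun _ => 1 / √(d : ℝ)

/-- The cone `H^ρ` of all `x` with nonnegative entries and `⟨x, ν*⟩ ≥ (1 - ρ) ‖x‖`. -/
def cone (d : ℕ) (ρ : ℝ) : Set (Rd d) :=
  {x | (∀ i, 0 ≤ x i) ∧ (1 - ρ) * ‖x‖ ≤ inner ℝ x (nuStar d)}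

/-- The closed spherical shell `S_{r,R}` centered at the origin. -/
def shell (d : ℕ) (r R : ℝ) : Set (Rd d) := Metric.closedBall 0 R \ Metric.ball 0 r

end Scattering

end

noncomputable section

namespace Scattering

variable {d : ℕ}

section Plancherel

open scoped SchwartzMap ContDiff

/-! ### Plancherel theory for functions -/

/-! The modulus moves energy towards frequency zero, and this is measured by a smoothness
functional. Let `variation t F` be the Gaussian average over `y` of `‖F(· + ty) - F‖₂²`. By
Plancherel it equals `∫ |F̂(ξ)|² m_t(‖ξ‖) dξ` with `m_t(r) = 2(1 - exp(-π(tr)²))`, a symbol that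
increases in `tr`.

For `u = F * g` the reverse triangle inequality gives `||u(x+h)| - |u(x)|| ≤ |e^{-2πi⟨h,c⟩} u(x+h) -
u(x)|` for every center `c`. Hence `variation t |F * g| ≤ ∫ |F̂|² |ĝ|² m_t(‖ξ - c‖)`. A
cone-and-shell piece has a center with `‖ξ - c‖ ≤ α‖ξ‖` on the support of `ĝ`
(`exists_center_of_cone`). Summing over the filters with the Bessel bound gives `∑_g variation t |F
* g| ≤ variation (tα) F` (`tsum_variation_propStep_le`): each layer shrinks the scale by `α`.

All filter frequencies are at least `δ > 0` in modulus, where `m_1` is bounded below, so one layer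
of energy is at most a constant times `variation 1`. Iterating, `W_{N+1}(F) ≤ C variation (α^N) F`
(`energy_succ_le`). Since `m_t(r) ≲ min(1, (tr)²)`, each rate reduces to a scalar inequality between
`min(1, (α^N r)²)` and the squared weight. For Sobolev and log-Sobolev signals `r = ‖ξ‖`; for
decomposition spaces the first layer is kept and recentered optimally, so that `r = d_g`. -/

theorem integral_fourier_mul_eq {f g : Rd d → ℂ} (hf : Integrable f) (hg : Integrable g) :
    ∫ ξ, 𝓕 f ξ * g ξ = ∫ x, f x * 𝓕 g x := by
  simpa using! (VectorFourier.integral_fourierIntegral_smul_eq_flip (L := innerₗ (Rd d))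
    Real.continuous_fourierChar continuous_inner hf hg)

theorem integral_schwartz_mul_fourier (F : L2 d) (g : 𝓢(Rd d, ℂ)) :
    ∫ x, g x * (𝓕 F : L2 d) x = ∫ x, 𝓕 (g : Rd d → ℂ) x * F x := by
  have h := congrArg (fun T => T g) (Lp.fourier_toTemperedDistribution_eq F)
  simp only [TemperedDistribution.fourier_apply, Lp.toTemperedDistribution_apply,
    smul_eq_mul] at h
  rw [← h]
  rfl

/-- Testing only against compactly supported functions suffices, and it keeps the class stable under
multiplication by a character, as `coeFn_fourier_translate` requires. -/
theorem ae_eq_of_integral_schwartz_mul_eq {u v : Rd d → ℂ} (hu : LocallyIntegrable u)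
    (hv : LocallyIntegrable v)
    (h : ∀ g : 𝓢(Rd d, ℂ), HasCompactSupport g → ∫ x, g x * u x = ∫ x, g x * v x) :
    u =ᵐ[volume] v := by
  refine ae_eq_of_integral_contDiff_smul_eq hu hv fun g hg hgc => ?_
  have hc : HasCompactSupport fun x => (g x : ℂ) := hgc.comp_left (g := fun r : ℝ => (r : ℂ)) rfl
  have hd : ContDiff ℝ ∞ fun x => (g x : ℂ) := Complex.ofRealCLM.contDiff.comp hg
  simpa using h (hc.toSchwartzMap hd) hc

theorem continuous_fourier {u : Rd d → ℂ} (hu : Integrable u) : Continuous (𝓕 u) :=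
  VectorFourier.fourierIntegral_continuous Real.continuous_fourierChar
    (by exact continuous_inner) hu

/-- Links the Plancherel transform to the Fourier integral: both have the same pairings with
Schwartz functions, by self-adjointness of the transform. -/
theorem coeFn_fourier_toLp {u : Rd d → ℂ} (h1 : Integrable u) (h2 : MemLp u 2) :
    (𝓕 (h2.toLp u) : L2 d) =ᵐ[volume] 𝓕 u := by
  refine ae_eq_of_integral_schwartz_mul_eq
    ((Lp.memLp _).locallyIntegrable (by norm_num))
    (continuous_fourier h1).locallyIntegrable fun g _ => ?_
  rw [integral_schwartz_mul_fourier, ← integral_fourier_mul_eq g.integrable h1]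
  refine integral_congr_ae ?_
  filter_upwards [h2.coeFn_toLp] with x hx
  rw [hx]

theorem eLpNorm_coeFn_fourier (F : L2 d) :
    eLpNorm (𝓕 F : L2 d) 2 volume = eLpNorm F 2 volume := by
  have h := Lp.norm_fourier_eq F
  rw [Lp.norm_def, Lp.norm_def] at h
  exact (ENNReal.toReal_eq_toReal_iff' (Lp.eLpNorm_ne_top _) (Lp.eLpNorm_ne_top _)).1 h

theorem memLp_fourier {u : Rd d → ℂ} (h1 : Integrable u) (h2 : MemLp u 2) : MemLp (𝓕 u) 2 :=
  (Lp.memLp (𝓕 (h2.toLp u) : L2 d)).ae_eq (coeFn_fourier_toLp h1 h2)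

theorem eLpNorm_fourier {u : Rd d → ℂ} (h1 : Integrable u) (h2 : MemLp u 2) :
    eLpNorm (𝓕 u) 2 volume = eLpNorm u 2 volume := by
  rw [← eLpNorm_congr_ae (coeFn_fourier_toLp h1 h2), eLpNorm_coeFn_fourier,
    eLpNorm_congr_ae h2.coeFn_toLp]

theorem eLpNorm_fourierInv {u : Rd d → ℂ} (h1 : Integrable u) (h2 : MemLp u 2) :
    eLpNorm (𝓕⁻ u) 2 volume = eLpNorm u 2 volume := by
  rw [← eLpNorm_fourier h1 h2]
  have : 𝓕⁻ u = 𝓕 u ∘ Neg.neg := by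
    ext x; exact Real.fourierInv_eq_fourier_neg u x
  rw [this, eLpNorm_comp_measurePreserving (memLp_fourier h1 h2).1
    (Measure.measurePreserving_neg volume)]

theorem memLp_fourierInv {u : Rd d → ℂ} (h1 : Integrable u) (h2 : MemLp u 2) :
    MemLp (𝓕⁻ u) 2 := by
  have : 𝓕⁻ u = 𝓕 u ∘ Neg.neg := by
    ext x; exact Real.fourierInv_eq_fourier_neg u x
  rw [this]
  exact (memLp_fourier h1 h2).comp_measurePreserving (Measure.measurePreserving_neg volume)

/-- The squared `L²`-norm as a lower Lebesgue integral. -/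
theorem eLpNorm_two_sq (u : Rd d → ℂ) : eLpNorm u 2 volume ^ 2 = ∫⁻ x, ‖u x‖ₑ ^ 2 := by
  rw [eLpNorm_eq_lintegral_rpow_enorm_toReal (by norm_num) (by norm_num),
    ← ENNReal.rpow_natCast, ← ENNReal.rpow_mul]
  norm_num

/-- The character `x ↦ e^{2πi⟨h, x⟩}`. -/
def character (h x : Rd d) : ℂ := (Real.fourierChar (inner ℝ h x) : ℂ)

theorem norm_character (h x : Rd d) : ‖character h x‖ = 1 := Circle.norm_coe _

theorem continuous_character (h : Rd d) : Continuous (character h) :=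
  continuous_subtype_val.comp (Real.continuous_fourierChar.comp (by fun_prop))

theorem character_eq_exp (h x : Rd d) :
    character h x = Complex.exp ((2 * Real.pi * inner ℝ h x : ℝ) * Complex.I) := by
  rw [character, Real.fourierChar_apply]

theorem contDiff_character (h : Rd d) : ContDiff ℝ ∞ (character h) := by
  have : character h = fun x => Complex.exp ((2 * Real.pi * inner ℝ h x : ℝ) * Complex.I) :=
    funext (character_eq_exp h)
  rw [this]
  have h1 : ContDiff ℝ ∞ fun x : Rd d => (2 * Real.pi * inner ℝ h x : ℝ) :=
    contDiff_const.mul (contDiff_const.inner ℝ contDiff_id)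
  exact ((Complex.ofRealCLM.contDiff.comp h1).mul contDiff_const).cexp

theorem fourier_character_mul (h : Rd d) (g : Rd d → ℂ) (x : Rd d) :
    𝓕 (fun y => character h y * g y) x = 𝓕 g (x - h) := by
  rw [Real.fourier_eq, Real.fourier_eq]
  refine integral_congr_ae (Eventually.of_forall fun y => ?_)
  simp only [character, Circle.smul_def, smul_eq_mul, ← mul_assoc, ← Circle.coe_mul,
    ← AddChar.map_add_eq_mul, inner_sub_right, real_inner_comm h y]
  congr 4
  ring

theorem fourierInv_character_mul (h : Rd d) (g : Rd d → ℂ) (x : Rd d) :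
    𝓕⁻ (fun y => character h y * g y) x = 𝓕⁻ g (x + h) := by
  rw [Real.fourierInv_eq, Real.fourierInv_eq]
  refine integral_congr_ae (Eventually.of_forall fun y => ?_)
  simp only [character, Circle.smul_def, smul_eq_mul, ← mul_assoc, ← Circle.coe_mul,
    ← AddChar.map_add_eq_mul, inner_add_right, real_inner_comm h y]

theorem memLp_translate {F : Rd d → ℂ} {p : ℝ≥0∞} (hF : MemLp F p) (h : Rd d) :
    MemLp (fun x => F (x + h)) p :=
  hF.comp_measurePreserving (measurePreserving_add_right volume h)

theorem coeFn_fourier_translate (F : L2 d) (h : Rd d) :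
    (𝓕 ((memLp_translate (Lp.memLp F) h).toLp _) : L2 d) =ᵐ[volume]
      fun ξ => character h ξ * (𝓕 F : L2 d) ξ := by
  refine ae_eq_of_integral_schwartz_mul_eq
    ((Lp.memLp _).locallyIntegrable (by norm_num)) ?_ fun g hg => ?_
  · have : MemLp (fun ξ => character h ξ * (𝓕 F : L2 d) ξ) 2 := by
      refine (Lp.memLp (𝓕 F : L2 d)).of_le
        ((continuous_character h).aestronglyMeasurable.mul (Lp.memLp (𝓕 F : L2 d)).1)
        (Eventually.of_forall fun x => ?_)
      rw [norm_mul, norm_character, one_mul]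
    exact this.locallyIntegrable (by norm_num)
  · have hc : HasCompactSupport fun x => character h x * g x := hg.mul_left
    have hs : ContDiff ℝ ∞ fun x => character h x * g x :=
      (contDiff_character h).mul g.smooth'
    have key := integral_schwartz_mul_fourier F (hc.toSchwartzMap hs)
    rw [integral_schwartz_mul_fourier]
    calc ∫ x, 𝓕 (g : Rd d → ℂ) x * (memLp_translate (Lp.memLp F) h).toLp _ x
        = ∫ x, 𝓕 (g : Rd d → ℂ) x * F (x + h) := by
          refine integral_congr_ae ?_
          filter_upwards [(memLp_translate (Lp.memLp F) h).coeFn_toLp] with x hx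
          rw [hx]
      _ = ∫ x, 𝓕 (g : Rd d → ℂ) (x - h) * F x := by
          rw [← integral_add_right_eq_self (fun x => 𝓕 (g : Rd d → ℂ) (x - h) * F x) h]
          simp
      _ = ∫ x, 𝓕 (fun y => character h y * g y) x * F x := by
          simp only [fourier_character_mul]
      _ = _ := by
          rw [show (fun y => character h y * g y) = hc.toSchwartzMap hs from rfl, ← key]
          refine integral_congr_ae (Eventually.of_forall fun x => ?_)
          simp [mul_assoc, mul_left_comm]

theorem lintegral_translate_sub (F : L2 d) (h : Rd d) :
    ∫⁻ x, ‖F (x + h) - F x‖ₑ ^ 2 =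
      ∫⁻ ξ, ‖(𝓕 F : L2 d) ξ‖ₑ ^ 2 * ‖character h ξ - 1‖ₑ ^ 2 := by
  set T : L2 d := (memLp_translate (Lp.memLp F) h).toLp _ with hT
  have h1 : (𝓕 (T - F) : L2 d) = 𝓕 T - 𝓕 F :=
    (Lp.fourierTransformₗᵢ (Rd d) ℂ).map_sub T F
  have h2 := eLpNorm_coeFn_fourier (T - F)
  have h3 := congrArg (· ^ 2) h2
  simp only [eLpNorm_two_sq] at h3
  calc ∫⁻ x, ‖F (x + h) - F x‖ₑ ^ 2 = ∫⁻ x, ‖(T - F : L2 d) x‖ₑ ^ 2 := by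
        refine lintegral_congr_ae ?_
        filter_upwards [Lp.coeFn_sub T F, (memLp_translate (Lp.memLp F) h).coeFn_toLp]
          with x hx hx'
        rw [hx, Pi.sub_apply, hT, hx']
    _ = _ := h3.symm
    _ = _ := by
        refine lintegral_congr_ae ?_
        rw [h1]
        filter_upwards [Lp.coeFn_sub (𝓕 T) (𝓕 F), coeFn_fourier_translate F h] with x hx hx'
        rw [hx, Pi.sub_apply, hT, hx', ← mul_pow, ← enorm_mul]
        congr 2
        ring

end Plancherel

/-! ### Convolution on the Fourier side -/

theorem conv_apply (f g : Rd d → ℂ) (x : Rd d) : conv f g x = ∫ t, f t * g (x - t) := by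
  simp [conv, convolution]

theorem fourier_reflect_conj (g : Rd d → ℂ) (x ξ : Rd d) :
    𝓕 (fun t => star (g (x - t))) ξ = star (character x ξ * 𝓕 g ξ) := by
  rw [Real.fourier_eq, Real.fourier_eq, character, star_mul']
  have h1 : ∀ t, Real.fourierChar (-inner ℝ t ξ) • star (g (x - t)) =
      star ((Real.fourierChar (inner ℝ x ξ) : ℂ) *
        (Real.fourierChar (-inner ℝ (x - t) ξ) • g (x - t))) := by
    intro t
    rw [Circle.smul_def, Circle.smul_def, smul_eq_mul, smul_eq_mul, ← mul_assoc,
      ← Circle.coe_mul, ← AddChar.map_add_eq_mul, star_mul', inner_sub_left]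
    congr 1
    rw [show inner ℝ x ξ + -(inner ℝ x ξ - inner ℝ t ξ) = inner ℝ t ξ by ring,
      AddChar.map_neg_eq_inv, Circle.coe_inv_eq_conj]
    rfl
  simp_rw [h1]
  rw [integral_sub_left_eq_self (fun t => star ((Real.fourierChar (inner ℝ x ξ) : ℂ) *
        (Real.fourierChar (-inner ℝ t ξ) • g t))) volume x]
  have := integral_conj (𝕜 := ℂ) (μ := (volume : Measure (Rd d)))
    (f := fun t => (Real.fourierChar (inner ℝ x ξ) : ℂ) *
        (Real.fourierChar (-inner ℝ t ξ) • g t))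
  rw [← star_mul', ← integral_const_mul]
  exact this

theorem integrable_fourier_mul (F : L2 d) {g : Rd d → ℂ} (h1 : Integrable g) (h2 : MemLp g 2) :
    Integrable fun ξ => (𝓕 F : L2 d) ξ * 𝓕 g ξ :=
  (Lp.memLp (𝓕 F : L2 d)).integrable_mul (memLp_fourier h1 h2)

theorem memLp_fourier_mul (F : L2 d) {g : Rd d → ℂ} (h1 : Integrable g) :
    MemLp (fun ξ => (𝓕 F : L2 d) ξ * 𝓕 g ξ) 2 := by
  refine MemLp.of_le_mul (c := ∫ x, ‖g x‖) (Lp.memLp (𝓕 F : L2 d))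
    ((Lp.memLp (𝓕 F : L2 d)).1.mul (continuous_fourier h1).aestronglyMeasurable)
    (Eventually.of_forall fun ξ => ?_)
  rw [norm_mul, mul_comm]
  gcongr
  exact VectorFourier.norm_fourierIntegral_le_integral_norm _ _ _ _ _

/-- The convolution theorem for `f ∈ L²` and `g ∈ L¹ ∩ L²`. -/
theorem conv_eq_fourierInv (F : L2 d) {g : Rd d → ℂ} (h1 : Integrable g) (h2 : MemLp g 2) :
    conv F g = 𝓕⁻ (fun ξ => (𝓕 F : L2 d) ξ * 𝓕 g ξ) := by
  ext x
  have k1 : Integrable fun t => star (g (x - t)) :=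
    memLp_one_iff_integrable.1 (memLp_one_iff_integrable.2 (h1.comp_sub_left x)).star
  have k2 : MemLp (fun t => star (g (x - t))) 2 :=
    (h2.comp_measurePreserving (Measure.measurePreserving_sub_left volume x)).star
  -- For fixed `x` the convolution is the inner product of `t ↦ conj g(x - t)` with `F`, so Parseval
  -- gives the identity at every point, not only almost everywhere.
  have h := Lp.inner_fourier_eq (k2.toLp _) F
  rw [L2.inner_def, L2.inner_def] at h
  rw [conv_apply, Real.fourierInv_eq]
  calc ∫ t, F t * g (x - t) = ∫ t, inner ℂ (k2.toLp _ t) (F t) := by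
        refine integral_congr_ae ?_
        filter_upwards [k2.coeFn_toLp] with t ht
        rw [ht]
        simp
    _ = _ := h.symm
    _ = _ := by
        refine integral_congr_ae ?_
        filter_upwards [coeFn_fourier_toLp k1 k2] with ξ hξ
        rw [hξ, fourier_reflect_conj, character, Circle.smul_def, real_inner_comm x ξ]
        simp
        ring

theorem memLp_conv (F : L2 d) {g : Rd d → ℂ} (h1 : Integrable g) (h2 : MemLp g 2) :
    MemLp (conv F g) 2 := by
  rw [conv_eq_fourierInv F h1 h2]
  exact memLp_fourierInv (integrable_fourier_mul F h1 h2) (memLp_fourier_mul F h1)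

theorem lintegral_conv (F : L2 d) {g : Rd d → ℂ} (h1 : Integrable g) (h2 : MemLp g 2) :
    ∫⁻ x, ‖conv F g x‖ₑ ^ 2 = ∫⁻ ξ, ‖(𝓕 F : L2 d) ξ‖ₑ ^ 2 * ‖𝓕 g ξ‖ₑ ^ 2 := by
  rw [← eLpNorm_two_sq, conv_eq_fourierInv F h1 h2,
    eLpNorm_fourierInv (integrable_fourier_mul F h1 h2) (memLp_fourier_mul F h1), eLpNorm_two_sq]
  simp_rw [enorm_mul, mul_pow]

/-- The modulus does not see unimodular factors, so the frequency origin may be moved to any `c`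
before comparing translates. This is the only place where the nonlinearity enters. -/
theorem norm_translate_propStep_sub_le (f g : Rd d → ℂ) (c h x : Rd d) :
    ‖propStep g f (x + h) - propStep g f x‖ ≤
      ‖character h (-c) * conv f g (x + h) - conv f g x‖ := by
  rw [propStep, propStep, ← Complex.ofReal_sub, Complex.norm_real, Real.norm_eq_abs]
  have := abs_norm_sub_norm_le (character h (-c) * conv f g (x + h)) (conv f g x)
  rwa [norm_mul, norm_character, one_mul] at this

theorem character_add (h x y : Rd d) : character h (x + y) = character h x * character h y := by
  rw [character, inner_add_right, AddChar.map_add_eq_mul, Circle.coe_mul]; rfl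

/-- On the Fourier side translation by `h` multiplies by `e^{2πi⟨h,ξ⟩}`; the extra phase turns this
into `e^{2πi⟨h,ξ-c⟩}`, which recenters the multiplier at `c`. -/
theorem lintegral_modulated_translate_conv (F : L2 d) {g : Rd d → ℂ} (h1 : Integrable g)
    (h2 : MemLp g 2) (c h : Rd d) :
    ∫⁻ x, ‖character h (-c) * conv F g (x + h) - conv F g x‖ₑ ^ 2 =
      ∫⁻ ξ, ‖(𝓕 F : L2 d) ξ‖ₑ ^ 2 * ‖𝓕 g ξ‖ₑ ^ 2 * ‖character h (ξ - c) - 1‖ₑ ^ 2 := by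
  set u : Rd d → ℂ := fun ξ => (𝓕 F : L2 d) ξ * 𝓕 g ξ with hu
  have hu1 : Integrable u := integrable_fourier_mul F h1 h2
  have hu2 : MemLp u 2 := memLp_fourier_mul F h1
  set v : Rd d → ℂ := fun ξ => (character h (ξ - c) - 1) * u ξ with hv
  have hcont : Continuous fun ξ => character h (ξ - c) - 1 :=
    ((continuous_character h).comp (continuous_id.sub continuous_const)).sub continuous_const
  have hb : ∀ ξ, ‖v ξ‖ ≤ 2 * ‖u ξ‖ := by
    intro ξ
    rw [hv, norm_mul]
    gcongr
    refine (norm_sub_le _ _).trans ?_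
    rw [norm_character, norm_one]
    norm_num
  have hv1 : Integrable v :=
    (hu1.norm.const_mul 2).mono' (hcont.aestronglyMeasurable.mul hu1.1) (Eventually.of_forall hb)
  have hv2 : MemLp v 2 :=
    hu2.of_le_mul (hcont.aestronglyMeasurable.mul hu2.1) (Eventually.of_forall hb)
  have hw1 : Integrable fun ξ => character h ξ * u ξ := by
    refine hu1.norm.mono' ((continuous_character h).aestronglyMeasurable.mul hu1.1)
      (Eventually.of_forall fun ξ => ?_)
    rw [norm_mul, norm_character, one_mul]
  have key : ∀ x, character h (-c) * conv F g (x + h) - conv F g x = 𝓕⁻ v x := by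
    intro x
    rw [conv_eq_fourierInv F h1 h2, ← hu, ← fourierInv_character_mul, Real.fourierInv_eq,
      Real.fourierInv_eq, Real.fourierInv_eq, ← integral_const_mul, ← integral_sub]
    · refine integral_congr_ae (Eventually.of_forall fun ξ => ?_)
      simp only [hv, sub_eq_add_neg ξ c, character_add, Circle.smul_def, smul_eq_mul]
      ring
    · refine Integrable.const_mul ?_ _
      have := (Real.fourierIntegral_convergent_iff (-x)).2 hw1
      simpa using! this
    · have := (Real.fourierIntegral_convergent_iff (-x)).2 hu1
      simpa using! this
  simp_rw [key]
  rw [← eLpNorm_two_sq, eLpNorm_fourierInv hv1 hv2, eLpNorm_two_sq]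
  simp_rw [hv, hu, enorm_mul, mul_pow]
  refine lintegral_congr fun ξ => ?_
  ring

/-! ### The Gaussian variation functional -/

/-- The density `e^{-π|y|²}` of the standard Gaussian weight. -/
def gaussianWeight (y : Rd d) : ℝ := Real.exp (-Real.pi * ‖y‖ ^ 2)

/-- The Gaussian average of the squared `L²`-moduli of continuity of `F` at scale `t`. -/
def variation (t : ℝ) (F : Rd d → ℂ) : ℝ≥0∞ :=
  ∫⁻ y, ENNReal.ofReal (gaussianWeight y) * ∫⁻ x, ‖F (x + t • y) - F x‖ₑ ^ 2

/-- The Fourier symbol of `variation t`, as a function of the modulus of the frequency. -/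
def variationSymbol (t r : ℝ) : ℝ := 2 * (1 - Real.exp (-Real.pi * (t * r) ^ 2))

theorem continuous_gaussianWeight : Continuous (gaussianWeight (d := d)) := by
  unfold gaussianWeight; fun_prop

theorem gaussianWeight_pos (y : Rd d) : 0 < gaussianWeight y := Real.exp_pos _

theorem integrable_gaussianWeight : Integrable (gaussianWeight (d := d)) := by
  have h := GaussianFourier.integrable_cexp_neg_mul_sq_norm_add (V := Rd d) (b := Real.pi)
    (by simpa using Real.pi_pos) 0 0
  have h2 := h.re
  refine h2.congr (Eventually.of_forall fun y => ?_)
  simp only [gaussianWeight, zero_mul, add_zero]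
  rw [← Complex.ofReal_pow, ← Complex.ofReal_neg, ← Complex.ofReal_mul]
  exact Complex.exp_ofReal_re _

theorem integral_gaussianWeight : ∫ y : Rd d, gaussianWeight y = 1 := by
  have h := GaussianFourier.integral_rexp_neg_mul_sq_norm (V := Rd d) Real.pi_pos
  rw [div_self Real.pi_ne_zero, Real.one_rpow] at h
  exact h

theorem fourier_gaussianWeight (w : Rd d) :
    𝓕 (fun y : Rd d => (gaussianWeight y : ℂ)) w = (Real.exp (-Real.pi * ‖w‖ ^ 2) : ℝ) := by
  have h := fourier_gaussian_innerProductSpace (V := Rd d) (b := Real.pi)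
    (by simpa using Real.pi_pos) w
  have hpi : (Real.pi : ℂ) ≠ 0 := by exact_mod_cast Real.pi_ne_zero
  rw [div_self hpi, Complex.one_cpow, one_mul] at h
  convert h using 1
  · refine congrArg (fun u : Rd d → ℂ => 𝓕 u w) (funext fun y => ?_)
    simp [gaussianWeight]
  · push_cast
    congr 1
    field_simp

theorem normSq_character_sub_one (h x : Rd d) :
    ‖character h x - 1‖ ^ 2 = 2 - 2 * (character h x).re := by
  have h1 := norm_character h x
  have h2 : Complex.normSq (character h x) = 1 := by
    rw [Complex.normSq_eq_norm_sq, h1, one_pow]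
  rw [← Complex.normSq_eq_norm_sq, Complex.normSq_sub, h2]
  simp
  ring

theorem integral_gaussianWeight_mul_character (t : ℝ) (ξ : Rd d) :
    ∫ y, gaussianWeight y * (character (t • y) ξ).re = Real.exp (-Real.pi * (t * ‖ξ‖) ^ 2) := by
  have h := fourier_gaussianWeight (-(t • ξ))
  rw [Real.fourier_eq] at h
  have hi : Integrable fun y : Rd d =>
      Real.fourierChar (-inner ℝ y (-(t • ξ))) • (gaussianWeight y : ℂ) :=
    (Real.fourierIntegral_convergent_iff _).2 integrable_gaussianWeight.ofReal
  have h2 := congrArg Complex.re h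
  rw [Complex.ofReal_re, norm_neg, norm_smul, Real.norm_eq_abs, mul_pow, sq_abs,
    ← mul_pow] at h2
  rw [← h2]
  refine (Eq.trans ?_ (integral_re hi))
  refine integral_congr_ae (Eventually.of_forall fun y => ?_)
  simp [character, Circle.smul_def, real_inner_smul_left, real_inner_smul_right, mul_comm]

/-- Expanding `|e^{iθ} - 1|² = 2 - 2 cos θ` reduces the average to the transform of the Gaussian,
which is its own Fourier transform. This makes the symbol radial and explicitly monotone. -/
theorem lintegral_gaussianWeight_mul_character (t : ℝ) (ξ : Rd d) :
    ∫⁻ y, ENNReal.ofReal (gaussianWeight y) * ‖character (t • y) ξ - 1‖ₑ ^ 2 =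
      ENNReal.ofReal (variationSymbol t ‖ξ‖) := by
  have hre : Integrable fun y : Rd d => gaussianWeight y * (character (t • y) ξ).re := by
    refine integrable_gaussianWeight.mono' ?_ (Eventually.of_forall fun y => ?_)
    · refine Continuous.aestronglyMeasurable (continuous_gaussianWeight.mul ?_)
      refine Complex.continuous_re.comp (continuous_subtype_val.comp
        (Real.continuous_fourierChar.comp ?_))
      fun_prop
    · rw [norm_mul, Real.norm_eq_abs, Real.norm_eq_abs,
        abs_of_pos (gaussianWeight_pos y)]
      have := (Complex.abs_re_le_norm (character (t • y) ξ)).trans_eq (norm_character _ _)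
      exact mul_le_of_le_one_right (gaussianWeight_pos y).le this
  have heq : ∀ y : Rd d, ENNReal.ofReal (gaussianWeight y) * ‖character (t • y) ξ - 1‖ₑ ^ 2 =
      ENNReal.ofReal (2 * gaussianWeight y - 2 * (gaussianWeight y * (character (t • y) ξ).re)) := by
    intro y
    rw [← ofReal_norm, ← ENNReal.ofReal_pow (norm_nonneg _),
      ← ENNReal.ofReal_mul (gaussianWeight_pos y).le, normSq_character_sub_one]
    congr 1
    ring
  have hint : Integrable fun y : Rd d =>
      2 * gaussianWeight y - 2 * (gaussianWeight y * (character (t • y) ξ).re) :=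
    (integrable_gaussianWeight.const_mul 2).sub (hre.const_mul 2)
  simp_rw [heq]
  rw [← ofReal_integral_eq_lintegral_ofReal hint,
    integral_sub (integrable_gaussianWeight.const_mul 2) (hre.const_mul 2), integral_const_mul,
    integral_const_mul, integral_gaussianWeight, integral_gaussianWeight_mul_character,
    variationSymbol]
  · congr 1
    ring
  · refine Eventually.of_forall fun y => ?_
    have h1 : 2 * gaussianWeight y - 2 * (gaussianWeight y * (character (t • y) ξ).re) =
        gaussianWeight y * ‖character (t • y) ξ - 1‖ ^ 2 := by
      rw [normSq_character_sub_one]; ring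
    simp only [Pi.zero_apply]
    rw [h1]
    exact mul_nonneg (gaussianWeight_pos y).le (sq_nonneg _)

theorem lintegral_gaussian_swap (t : ℝ) (c : Rd d) {w : Rd d → ℝ≥0∞} (hw : AEMeasurable w) :
    ∫⁻ y, ENNReal.ofReal (gaussianWeight y) *
        ∫⁻ ξ, w ξ * ‖character (t • y) (ξ - c) - 1‖ₑ ^ 2 =
      ∫⁻ ξ, w ξ * ENNReal.ofReal (variationSymbol t ‖ξ - c‖) := by
  have hc : Continuous fun p : Rd d × Rd d => character (t • p.1) (p.2 - c) - 1 := by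
    refine Continuous.sub (continuous_subtype_val.comp
        (Real.continuous_fourierChar.comp ?_)) continuous_const
    fun_prop
  have hmeas : ∀ y : Rd d, AEMeasurable fun ξ => w ξ * ‖character (t • y) (ξ - c) - 1‖ₑ ^ 2 :=
    fun y => hw.mul ((hc.comp (Continuous.prodMk_right y)).measurable.enorm.pow_const 2).aemeasurable
  calc _ = ∫⁻ y, ∫⁻ ξ, ENNReal.ofReal (gaussianWeight y) *
        (w ξ * ‖character (t • y) (ξ - c) - 1‖ₑ ^ 2) := by
        refine lintegral_congr fun y => ?_
        rw [lintegral_const_mul'' _ (hmeas y)]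
    _ = ∫⁻ ξ, ∫⁻ y, ENNReal.ofReal (gaussianWeight y) *
        (w ξ * ‖character (t • y) (ξ - c) - 1‖ₑ ^ 2) := by
        refine lintegral_lintegral_swap ?_
        refine AEMeasurable.mul ?_ (AEMeasurable.mul (hw.comp_snd) ?_)
        · exact ((continuous_gaussianWeight.comp continuous_fst).measurable.ennreal_ofReal).aemeasurable
        · exact (hc.measurable.enorm.pow_const 2).aemeasurable
    _ = _ := by
        refine lintegral_congr fun ξ => ?_
        rw [← lintegral_gaussianWeight_mul_character t (ξ - c), ← lintegral_const_mul]
        · refine lintegral_congr fun y => ?_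
          ring
        · exact continuous_gaussianWeight.measurable.ennreal_ofReal.mul
            ((hc.comp (Continuous.prodMk_left ξ)).measurable.enorm.pow_const 2)

theorem variation_congr {F F' : Rd d → ℂ} (h : F =ᵐ[volume] F') (t : ℝ) :
    variation t F = variation t F' := by
  refine lintegral_congr fun y => ?_
  congr 1
  refine lintegral_congr_ae ?_
  have h2 := (measurePreserving_add_right (volume : Measure (Rd d)) (t • y)).quasiMeasurePreserving.ae h
  filter_upwards [h, h2] with x hx hx2
  rw [hx, hx2]

theorem variation_eq_lintegral (t : ℝ) (F : L2 d) :
    variation t F =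
      ∫⁻ ξ, ‖(𝓕 F : L2 d) ξ‖ₑ ^ 2 * ENNReal.ofReal (variationSymbol t ‖ξ‖) := by
  have h := lintegral_gaussian_swap t (0 : Rd d) (w := fun ξ => ‖(𝓕 F : L2 d) ξ‖ₑ ^ 2)
    ((Lp.memLp (𝓕 F : L2 d)).1.enorm.pow_const 2)
  simp only [sub_zero] at h
  rw [← h, variation]
  simp_rw [lintegral_translate_sub]

theorem variation_propStep_le (t : ℝ) (F : L2 d) {g : Rd d → ℂ} (h1 : Integrable g)
    (h2 : MemLp g 2) (c : Rd d) :
    variation t (propStep g F) ≤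
      ∫⁻ ξ, ‖(𝓕 F : L2 d) ξ‖ₑ ^ 2 * ‖𝓕 g ξ‖ₑ ^ 2 *
        ENNReal.ofReal (variationSymbol t ‖ξ - c‖) := by
  have hw : AEMeasurable fun ξ => ‖(𝓕 F : L2 d) ξ‖ₑ ^ 2 * ‖𝓕 g ξ‖ₑ ^ 2 :=
    ((Lp.memLp (𝓕 F : L2 d)).1.enorm.pow_const 2).mul
      ((continuous_fourier h1).measurable.enorm.pow_const 2).aemeasurable
  rw [← lintegral_gaussian_swap t c hw, variation]
  simp_rw [← lintegral_modulated_translate_conv F h1 h2 c]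
  gcongr with y x
  rw [enorm_le_iff_norm_le]
  exact norm_translate_propStep_sub_le _ _ _ _ _

theorem variationSymbol_mono {t r t' r' : ℝ} (h0 : 0 ≤ t * r) (h : t * r ≤ t' * r') :
    variationSymbol t r ≤ variationSymbol t' r' := by
  unfold variationSymbol
  have : (t * r) ^ 2 ≤ (t' * r') ^ 2 := by gcongr
  have := Real.pi_pos
  gcongr 2 * (1 - Real.exp ?_)
  nlinarith

theorem variationSymbol_le_two (t r : ℝ) : variationSymbol t r ≤ 2 := by
  unfold variationSymbol
  linarith [Real.exp_pos (-Real.pi * (t * r) ^ 2)]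

theorem variationSymbol_le_sq (t r : ℝ) : variationSymbol t r ≤ 2 * Real.pi * (t * r) ^ 2 := by
  unfold variationSymbol
  linarith [Real.add_one_le_exp (-Real.pi * (t * r) ^ 2)]

theorem variationSymbol_pos {t r : ℝ} (h : t * r ≠ 0) : 0 < variationSymbol t r := by
  unfold variationSymbol
  have : Real.exp (-Real.pi * (t * r) ^ 2) < 1 := by
    rw [Real.exp_lt_one_iff]
    have := Real.pi_pos
    have : 0 < (t * r) ^ 2 := by positivity
    nlinarith
  linarith

/-! ### Energy decay for contractive filter banks -/

/-- A countable Bessel family of band-limited filters with frequencies bounded below by `δ`, such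
that recentering the frequency support of a filter decreases moduli by the factor `α`. -/
structure IsContractiveBank (Ψ : Set (L2 d)) (α δ : ℝ) : Prop where
  countable : Ψ.Countable
  integrable : ∀ g ∈ Ψ, Integrable (g : Rd d → ℂ)
  compact : ∀ g ∈ Ψ, HasCompactSupport (𝓕 (g : Rd d → ℂ))
  bessel : ∀ᵐ ξ : Rd d, ∑' g : Ψ, ‖𝓕 ((g : L2 d) : Rd d → ℂ) ξ‖ₑ ^ 2 ≤ 1
  contract : ∀ g ∈ Ψ, ∃ c : Rd d, ∀ ξ, 𝓕 (g : Rd d → ℂ) ξ ≠ 0 → ‖ξ - c‖ ≤ α * ‖ξ‖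
  highpass : ∀ g ∈ Ψ, ∀ ξ, 𝓕 (g : Rd d → ℂ) ξ ≠ 0 → δ ≤ ‖ξ‖

theorem conv_congr_left {f f' : Rd d → ℂ} (h : f =ᵐ[volume] f') (g : Rd d → ℂ) :
    conv f g = conv f' g := by
  ext x
  rw [conv_apply, conv_apply]
  refine integral_congr_ae ?_
  filter_upwards [h] with t ht
  rw [ht]

theorem prop_congr (p : List (Rd d → ℂ)) {f f' : Rd d → ℂ} (h : f =ᵐ[volume] f') :
    prop p f =ᵐ[volume] prop p f' := by
  cases p with
  | nil => exact h
  | cons g p =>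
    have : propStep g f = propStep g f' := by
      unfold propStep; rw [conv_congr_left h]
    simp only [prop]
    rw [this]

theorem memLp_propStep (F : L2 d) {g : Rd d → ℂ} (h1 : Integrable g) (h2 : MemLp g 2) :
    MemLp (propStep g F) 2 :=
  (memLp_conv F h1 h2).norm.ofReal

theorem eLpNorm_propStep (f g : Rd d → ℂ) :
    eLpNorm (propStep g f) 2 volume = eLpNorm (conv f g) 2 volume := by
  refine eLpNorm_congr_norm_ae (Eventually.of_forall fun x => ?_)
  simp [propStep]

theorem energy_zero (Ψ : Set (L2 d)) (F : L2 d) :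
    energy Ψ 0 F = eLpNorm F 2 volume ^ 2 := by
  unfold energy
  rw [tsum_eq_single default (fun p hp => (hp (Subsingleton.elim _ _)).elim)]
  simp [prop]

namespace IsContractiveBank

variable {Ψ : Set (L2 d)} {α δ : ℝ}

theorem energy_succ (hΨ : IsContractiveBank Ψ α δ) (N : ℕ) (F : L2 d) :
    energy Ψ (N + 1) F = ∑' g : Ψ, energy Ψ N
      ((memLp_propStep F (hΨ.integrable g g.2) (Lp.memLp (g : L2 d))).toLp _) := by
  unfold energy
  rw [← (Fin.consEquiv fun _ : Fin (N + 1) => Ψ).tsum_eq, ENNReal.tsum_prod']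
  refine tsum_congr fun g => tsum_congr fun p => ?_
  congr 1
  rw [eLpNorm_congr_ae (prop_congr _ (MemLp.coeFn_toLp _))]
  simp [Fin.consEquiv, List.ofFn_succ, prop]

theorem tsum_lintegral_le (hΨ : IsContractiveBank Ψ α δ) (F : L2 d) {m : Rd d → ℝ≥0∞}
    (hm : Measurable m) :
    ∑' g : Ψ, ∫⁻ ξ, ‖(𝓕 F : L2 d) ξ‖ₑ ^ 2 * ‖𝓕 ((g : L2 d) : Rd d → ℂ) ξ‖ₑ ^ 2 * m ξ ≤
      ∫⁻ ξ, ‖(𝓕 F : L2 d) ξ‖ₑ ^ 2 * m ξ := by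
  have := hΨ.countable.to_subtype
  rw [← lintegral_tsum]
  · refine lintegral_mono_ae ?_
    filter_upwards [hΨ.bessel] with ξ hξ
    rw [ENNReal.tsum_mul_right, ENNReal.tsum_mul_left]
    gcongr
    exact mul_le_of_le_one_right zero_le hξ
  · intro g
    exact ((((Lp.memLp (𝓕 F : L2 d)).1.enorm.pow_const 2).mul
      ((continuous_fourier (hΨ.integrable g g.2)).measurable.enorm.pow_const 2).aemeasurable)).mul
      hm.aemeasurable

theorem measurable_variationSymbol (t : ℝ) :
    Measurable fun ξ : Rd d => ENNReal.ofReal (variationSymbol t ‖ξ‖) := by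
  unfold variationSymbol
  fun_prop

/-- The contraction step. Each filter uses its own center; monotonicity of the symbol trades `‖ξ -
c‖` for `α‖ξ‖`, after which the bound no longer depends on the filter and the Bessel inequality sums
it. -/
theorem tsum_variation_propStep_le (hΨ : IsContractiveBank Ψ α δ) {t : ℝ} (ht : 0 ≤ t)
    (F : L2 d) :
    ∑' g : Ψ, variation t (propStep ((g : L2 d) : Rd d → ℂ) F) ≤ variation (t * α) F := by
  rw [variation_eq_lintegral]
  refine le_trans (ENNReal.tsum_le_tsum fun g => ?_)
    (hΨ.tsum_lintegral_le F (measurable_variationSymbol (t * α)))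
  obtain ⟨c, hc⟩ := hΨ.contract g g.2
  refine (variation_propStep_le t F (hΨ.integrable g g.2) (Lp.memLp (g : L2 d)) c).trans ?_
  refine lintegral_mono fun ξ => ?_
  by_cases h : 𝓕 ((g : L2 d) : Rd d → ℂ) ξ = 0
  · simp [h]
  · gcongr
    refine variationSymbol_mono (by positivity) ?_
    rw [mul_assoc]
    gcongr
    exact hc ξ h

/-- The symbol vanishes only at frequency zero, which the filters avoid: where `ĝ ≠ 0` it is at
least `variationSymbol 1 δ`. -/
theorem energy_one_le (hΨ : IsContractiveBank Ψ α δ) (hδ : 0 < δ) (F : L2 d) :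
    energy Ψ 1 F ≤ ENNReal.ofReal (variationSymbol 1 δ)⁻¹ * variation 1 F := by
  rw [hΨ.energy_succ, variation_eq_lintegral, ← lintegral_const_mul' _ _
    ENNReal.ofReal_ne_top]
  have h2 : ∀ ξ : Rd d, ENNReal.ofReal (variationSymbol 1 δ)⁻¹ *
      (‖(𝓕 F : L2 d) ξ‖ₑ ^ 2 * ENNReal.ofReal (variationSymbol 1 ‖ξ‖)) =
      ‖(𝓕 F : L2 d) ξ‖ₑ ^ 2 * (ENNReal.ofReal (variationSymbol 1 δ)⁻¹ *
        ENNReal.ofReal (variationSymbol 1 ‖ξ‖)) := fun ξ => by ring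
  simp_rw [h2]
  refine le_trans (ENNReal.tsum_le_tsum fun g => ?_)
    (hΨ.tsum_lintegral_le F ((measurable_variationSymbol 1).const_mul _))
  have hg := hΨ.integrable g g.2
  rw [energy_zero, eLpNorm_congr_ae (MemLp.coeFn_toLp _), eLpNorm_propStep, eLpNorm_two_sq,
    lintegral_conv F hg (Lp.memLp (g : L2 d))]
  refine lintegral_mono fun ξ => ?_
  by_cases h : 𝓕 ((g : L2 d) : Rd d → ℂ) ξ = 0
  · simp [h]
  · refine le_mul_of_one_le_right zero_le ?_
    have hpos : 0 < variationSymbol 1 δ := variationSymbol_pos (by simpa using hδ.ne')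
    rw [← ENNReal.ofReal_mul (by positivity), ENNReal.one_le_ofReal, inv_mul_eq_div,
      one_le_div hpos]
    refine variationSymbol_mono (by positivity) ?_
    gcongr
    exact hΨ.highpass g g.2 ξ h

theorem energy_succ_le (hΨ : IsContractiveBank Ψ α δ) (hδ : 0 < δ) (hα : 0 ≤ α) (N : ℕ)
    (F : L2 d) :
    energy Ψ (N + 1) F ≤ ENNReal.ofReal (variationSymbol 1 δ)⁻¹ * variation (α ^ N) F := by
  induction N generalizing F with
  | zero => simpa using hΨ.energy_one_le hδ F
  | succ N ih =>
    rw [hΨ.energy_succ]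
    refine (ENNReal.tsum_le_tsum fun g => ih _).trans ?_
    rw [ENNReal.tsum_mul_left]
    gcongr
    simp_rw [variation_congr (MemLp.coeFn_toLp _), pow_succ]
    exact hΨ.tsum_variation_propStep_le (by positivity) F

/-- Stops the iteration one layer early, so that the first-layer outputs `|F * g|` stay visible;
decomposition spaces control exactly these. -/
theorem energy_add_two_le (hΨ : IsContractiveBank Ψ α δ) (hδ : 0 < δ) (hα : 0 ≤ α) (N : ℕ)
    (F : L2 d) :
    energy Ψ (N + 2) F ≤ ENNReal.ofReal (variationSymbol 1 δ)⁻¹ *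
      ∑' g : Ψ, variation (α ^ N) (propStep ((g : L2 d) : Rd d → ℂ) F) := by
  rw [hΨ.energy_succ, ← ENNReal.tsum_mul_left]
  refine ENNReal.tsum_le_tsum fun g => (hΨ.energy_succ_le hδ hα N _).trans_eq ?_
  rw [variation_congr (MemLp.coeFn_toLp _)]

end IsContractiveBank

theorem variation_propStep_le_freqRadius {t : ℝ} (ht : 0 ≤ t) (F : L2 d) {g : Rd d → ℂ}
    (h1 : Integrable g) (h2 : MemLp g 2) (hg : HasCompactSupport (𝓕 g)) :
    variation t (propStep g F) ≤
      ENNReal.ofReal (variationSymbol t (freqRadius g)) * eLpNorm (conv F g) 2 volume ^ 2 := by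
  have hK : eLpNorm (conv F g) 2 volume ^ 2 ≠ ⊤ :=
    ENNReal.pow_ne_top (memLp_conv F h1 h2).2.ne
  have key : ∀ r, freqRadius g < r → variation t (propStep g F) ≤
      ENNReal.ofReal (variationSymbol t r) * eLpNorm (conv F g) 2 volume ^ 2 := by
    intro r hr
    obtain ⟨c, hc⟩ := exists_lt_of_ciInf_lt hr
    -- Compact support bounds the supremum, so `⨆` is a true supremum and not its default value.
    have hb : BddAbove (range fun ξ : tsupport (𝓕 g) => ‖(ξ : Rd d) - c‖) := by
      have := (hg.isCompact.image (f := fun ξ => ‖ξ - c‖) (by fun_prop)).bddAbove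
      rwa [image_eq_range] at this
    refine (variation_propStep_le t F h1 h2 c).trans ?_
    rw [eLpNorm_two_sq, lintegral_conv F h1 h2, mul_comm, ← lintegral_mul_const' _ _
      ENNReal.ofReal_ne_top]
    refine lintegral_mono fun ξ => ?_
    by_cases h : 𝓕 g ξ = 0
    · simp [h]
    · gcongr
      refine variationSymbol_mono (by positivity) ?_
      gcongr
      exact (le_ciSup hb ⟨ξ, subset_tsupport _ h⟩).trans hc.le
  -- The infimum over centers need not be known to be attained: the bound holds for each `r >
  -- freqRadius g` and passes to the limit by continuity of the symbol.
  refine ge_of_tendsto (x := nhdsWithin (freqRadius g) (Ioi (freqRadius g)))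
    (f := fun r => ENNReal.ofReal (variationSymbol t r) * eLpNorm (conv F g) 2 volume ^ 2) ?_
    (eventually_nhdsWithin_of_forall key)
  refine ENNReal.Tendsto.mul_const (ENNReal.tendsto_ofReal ?_) (Or.inr hK)
  have : Continuous fun r => variationSymbol t r := by
    unfold variationSymbol; fun_prop
  exact (this.tendsto _).mono_left nhdsWithin_le_nhds

theorem freqRadius_nonneg (g : Rd d → ℂ) : 0 ≤ freqRadius g :=
  Real.iInf_nonneg fun _ => Real.iSup_nonneg fun _ => norm_nonneg _

/-! ### Wavelet filter banks -/

theorem norm_nuStar (hd : 1 ≤ d) : ‖nuStar d‖ = 1 := by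
  have hd' : (0 : ℝ) < d := by exact_mod_cast hd
  rw [EuclideanSpace.norm_eq]
  simp only [nuStar, Real.norm_eq_abs, sq_abs, div_pow, one_pow, Real.sq_sqrt hd'.le,
    Finset.sum_const, Finset.card_univ, Fintype.card_fin, nsmul_eq_mul]
  rw [mul_one_div_cancel hd'.ne', Real.sqrt_one]

/-- A conical piece of a spherical shell has a center relative to which all moduli decrease. -/
theorem exists_center_of_cone (hd : 1 ≤ d) (A : Od d) {ρ r R : ℝ} (hρ : ρ < 1) (hr : 0 < r) :
    ∃ c : Rd d, ∀ η ∈ (A '' cone d ρ) ∩ shell d r R,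
      ‖η - c‖ ≤ √(1 - 4 * (r * R) / (r + R) ^ 2 * (1 - ρ) ^ 2) * ‖η‖ := by
  -- The harmonic mean of `r` and `R`: it makes `2s/u - s²/u²` equal at `u = r` and `u = R`, which
  -- balances the two extreme radii. The inequality in between is `(u - r)(R - u) ≥ 0`.
  set s : ℝ := 2 * (r * R) / (r + R) with hs
  refine ⟨((1 - ρ) * s) • A (nuStar d), ?_⟩
  rintro _ ⟨⟨x, hx, rfl⟩, hR, hr'⟩
  simp only [Metric.mem_closedBall, Metric.mem_ball, dist_zero_right, not_lt,
    LinearIsometryEquiv.norm_map] at hR hr' ⊢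
  set u := ‖x‖ with hu
  have hu0 : 0 < u := hr.trans_le hr'
  have hR0 : 0 < R := hu0.trans_le hR
  have hD : 0 < r + R := by positivity
  have h1 : ‖A x - ((1 - ρ) * s) • A (nuStar d)‖ ^ 2 =
      u ^ 2 - 2 * ((1 - ρ) * s) * inner ℝ x (nuStar d) + ((1 - ρ) * s) ^ 2 := by
    rw [← map_smul, ← map_sub, LinearIsometryEquiv.norm_map, norm_sub_sq_real,
      real_inner_smul_right, norm_smul, norm_nuStar hd, mul_one, Real.norm_eq_abs, sq_abs]
    ring
  have h2 : 4 * (r * R) / (r + R) ^ 2 * u ^ 2 ≤ 2 * s * u - s ^ 2 := by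
    have : 2 * s * u - s ^ 2 - 4 * (r * R) / (r + R) ^ 2 * u ^ 2 =
        4 * (r * R) / (r + R) ^ 2 * ((u - r) * (R - u)) := by
      rw [hs]; field_simp; ring
    have h3 : 0 ≤ 4 * (r * R) / (r + R) ^ 2 * ((u - r) * (R - u)) :=
      mul_nonneg (by positivity) (mul_nonneg (by linarith) (by linarith))
    linarith
  have hs0 : 0 ≤ (1 - ρ) * s := mul_nonneg (by linarith) (by positivity)
  have h4 : ‖A x - ((1 - ρ) * s) • A (nuStar d)‖ ^ 2 ≤
      (1 - 4 * (r * R) / (r + R) ^ 2 * (1 - ρ) ^ 2) * u ^ 2 := by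
    rw [h1]
    have h5 := mul_le_mul_of_nonneg_left hx.2 hs0
    have h6 := mul_le_mul_of_nonneg_left h2 (sq_nonneg (1 - ρ))
    rw [← hu] at h5
    linarith
  refine ((le_abs_self _).trans (Real.abs_le_sqrt h4)).trans_eq ?_
  rw [Real.sqrt_mul' _ (sq_nonneg u), Real.sqrt_sq hu0.le]

theorem fourier_dilate {a : ℝ} (ha : 0 < a) (ψ : Rd d → ℂ) (j : ℤ) (M : Od d) (ξ : Rd d) :
    𝓕 (dilate a ψ j M) ξ = 𝓕 ψ (a ^ (-j) • (M⁻¹ ξ)) := by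
  have h1 : dilate a ψ j M =
      (fun y => ((a ^ ((d : ℤ) * j) : ℝ) : ℂ) * ψ (a ^ j • y)) ∘ (M⁻¹ : Od d) := rfl
  rw [h1, Real.fourier_comp_linearIsometry, Real.fourier_eq, Real.fourier_eq]
  have haj : (0 : ℝ) < a ^ j := zpow_pos ha j
  have h2 := Measure.integral_comp_smul (volume : Measure (Rd d))
    (fun y => Real.fourierChar (-inner ℝ y (a ^ (-j) • (M⁻¹ ξ))) • ψ y) (a ^ j)
  rw [finrank_euclideanSpace_fin, abs_of_pos (by positivity)] at h2
  have h3 : (∫ y, Real.fourierChar (-inner ℝ y (a ^ (-j) • (M⁻¹ ξ))) • ψ y) =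
      ((a ^ j) ^ d : ℝ) • ∫ x : Rd d,
        Real.fourierChar (-inner ℝ (a ^ j • x) (a ^ (-j) • (M⁻¹ ξ))) • ψ (a ^ j • x) := by
    rw [h2, smul_smul, mul_inv_cancel₀ (by positivity), one_smul]
  rw [h3, ← integral_smul]
  refine integral_congr_ae (Eventually.of_forall fun y => ?_)
  have hin : inner ℝ (a ^ j • y) (a ^ (-j) • (M⁻¹ ξ)) = inner ℝ y (M⁻¹ ξ) := by
    rw [real_inner_smul_left, real_inner_smul_right, zpow_neg, mul_inv_cancel_left₀ haj.ne']
  have hpow : a ^ ((d : ℤ) * j) = (a ^ j) ^ d := by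
    rw [mul_comm (d : ℤ) j, zpow_mul, zpow_natCast]
  simp only [hin, hpow, Circle.smul_def, smul_eq_mul, Complex.real_smul]
  ring

theorem integrable_dilate {a : ℝ} (ha : 0 < a) {ψ : Rd d → ℂ} (hψ : Integrable ψ) (j : ℤ)
    (M : Od d) : Integrable (dilate a ψ j M) := by
  have h1 : Integrable fun y => ((a ^ ((d : ℤ) * j) : ℝ) : ℂ) * ψ (a ^ j • y) :=
    (hψ.comp_smul (zpow_pos ha j).ne').const_mul _
  exact (M⁻¹ : Od d).measurePreserving.integrable_comp_of_integrable h1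

theorem fourier_eq_of_mem_wav {a : ℝ} (ha : 0 < a) {ψ : Rd d → ℂ} {j : ℤ} {M : Od d}
    {g : Rd d → ℂ} (hg : g =ᵐ[volume] dilate a ψ j M) (ξ : Rd d) :
    𝓕 g ξ = 𝓕 ψ (a ^ (-j) • (M⁻¹ ξ)) := by
  rw [Real.fourier_congr_ae hg, fourier_dilate ha]

theorem norm_dilation {a : ℝ} (ha : 0 < a) (j : ℤ) (M : Od d) (ξ : Rd d) :
    ‖a ^ (-j) • (M⁻¹ ξ)‖ = a ^ (-j) * ‖ξ‖ := by
  rw [norm_smul, LinearIsometryEquiv.norm_map, Real.norm_of_nonneg (zpow_pos ha _).le]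

theorem wav_bessel {a : ℝ} (ha : 1 < a) {G : Subgroup (Od d)} {ψ φ : Rd d → ℂ}
    (hadm : IsAdmissible a G ψ φ) (J : ℤ) :
    ∀ᵐ ξ : Rd d, ∑' g : wav ψ a G J, ‖𝓕 ((g : L2 d) : Rd d → ℂ) ξ‖ₑ ^ 2 ≤ 1 := by
  have ha0 : 0 < a := by linarith
  -- The Littlewood–Paley identity is used at `a^J ξ`, which shifts the scales `j ≥ 1` to `j > -J`.
  have h := (Measure.quasiMeasurePreserving_smul (volume : Measure (Rd d))
    (zpow_pos ha0 J).ne').ae hadm.littlewoodPaley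
  filter_upwards [h] with ξ hξ
  have hex : ∀ g : wav ψ a G J, ∃ p : ℕ × G, ((g : L2 d) : Rd d → ℂ) =ᵐ[volume]
      dilate a ψ ((p.1 : ℤ) + 1 - J) p.2 := by
    rintro ⟨g, j, hj, M, hM, hg⟩
    refine ⟨⟨(j + J - 1).toNat, M, hM⟩, ?_⟩
    rw [show (((j + J - 1).toNat : ℤ) + 1 - J) = j by omega]
    exact hg
  choose p hp using hex
  -- Filters are almost-everywhere classes, so one index determines one filter. Distinct indices may
  -- give the same filter, which only lowers the sum.
  have hinj : Function.Injective p := by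
    intro g g' hgg
    have h1 := hp g
    rw [hgg] at h1
    exact Subtype.ext (Lp.ext (h1.trans (hp g').symm))
  have hval : ∀ g : wav ψ a G J, ‖𝓕 ((g : L2 d) : Rd d → ℂ) ξ‖ₑ ^ 2 =
      ‖𝓕 ψ (a ^ (-(((p g).1 : ℤ) + 1)) • (((p g).2 : Od d)⁻¹ (a ^ J • ξ)))‖ₑ ^ 2 := by
    intro g
    rw [fourier_eq_of_mem_wav ha0 (hp g), map_smul, smul_smul, ← zpow_add₀ ha0.ne',
      show -(((p g).1 : ℤ) + 1 - J) = -(((p g).1 : ℤ) + 1) + J by ring]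
  simp_rw [hval]
  refine (ENNReal.tsum_comp_le_tsum_of_injective hinj fun q : ℕ × G =>
    ‖𝓕 ψ (a ^ (-((q.1 : ℤ) + 1)) • ((q.2 : Od d)⁻¹ (a ^ J • ξ)))‖ₑ ^ 2).trans ?_
  rw [ENNReal.tsum_prod']
  exact le_add_self.trans_eq hξ

theorem wav_countable {a : ℝ} (G : Subgroup (Od d)) [Finite G] (ψ : Rd d → ℂ) (J : ℤ) :
    (wav ψ a G J).Countable := by
  have hex : ∀ g : wav ψ a G J, ∃ p : ℤ × G, ((g : L2 d) : Rd d → ℂ) =ᵐ[volume]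
      dilate a ψ p.1 p.2 := by
    rintro ⟨g, j, hj, M, hM, hg⟩
    exact ⟨(j, ⟨M, hM⟩), hg⟩
  choose p hp using hex
  have hinj : Function.Injective p := by
    intro g g' hgg
    have h1 := hp g
    rw [hgg] at h1
    exact Subtype.ext (Lp.ext (h1.trans (hp g').symm))
  exact hinj.countable

theorem isContractiveBank_wav (hd : 1 ≤ d) {a : ℝ} (ha : 1 < a) {G : Subgroup (Od d)}
    [Finite G] (J : ℤ) {ψ φ : Rd d → ℂ} (hadm : IsAdmissible a G ψ φ) (A : Od d) {ρ : ℝ}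
    (hρ : ρ < 1) {κ : ℕ}
    (hsupp : tsupport (𝓕 ψ) ⊆ (A '' cone d ρ) ∩ shell d a⁻¹ (a ^ ((κ : ℤ) - 1))) :
    IsContractiveBank (wav ψ a G J)
      √(1 - 4 * a ^ κ / (1 + a ^ κ) ^ 2 * (1 - ρ) ^ 2) (a ^ (-J)) := by
  have ha0 : 0 < a := by linarith
  have hψ : Integrable ψ := memLp_one_iff_integrable.1 hadm.memL1_wavelet
  have hmem : ∀ {j : ℤ} {M : Od d} {g : Rd d → ℂ} {ξ : Rd d}, g =ᵐ[volume] dilate a ψ j M →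
      𝓕 g ξ ≠ 0 → a ^ (-j) • (M⁻¹ ξ) ∈
        (A '' cone d ρ) ∩ shell d a⁻¹ (a ^ ((κ : ℤ) - 1)) := by
    intro j M g ξ hg h
    rw [fourier_eq_of_mem_wav ha0 hg] at h
    exact hsupp (subset_tsupport _ h)
  refine ⟨wav_countable G ψ J, ?_, ?_, wav_bessel ha hadm J, ?_, ?_⟩
  · rintro g ⟨j, hj, M, hM, hg⟩
    exact (integrable_dilate ha0 hψ j M).congr hg.symm
  · rintro g ⟨j, hj, M, hM, hg⟩
    refine HasCompactSupport.intro
      (isCompact_closedBall (0 : Rd d) (a ^ j * a ^ ((κ : ℤ) - 1))) fun ξ hξ => ?_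
    by_contra h
    have h1 := (hmem hg h).2.1
    rw [mem_closedBall_zero_iff, norm_dilation ha0, zpow_neg, inv_mul_le_iff₀ (zpow_pos ha0 j)] at h1
    exact hξ (mem_closedBall_zero_iff.2 h1)
  · rintro g ⟨j, hj, M, hM, hg⟩
    obtain ⟨c, hc⟩ := exists_center_of_cone hd A (R := a ^ ((κ : ℤ) - 1)) hρ (inv_pos.2 ha0)
    -- The center of the mother wavelet is carried along by the dilation and rotation; the
    -- contraction ratio is scale invariant.
    refine ⟨a ^ j • M c, fun ξ hξ => ?_⟩
    have h1 := hc _ (hmem hg hξ)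
    have hconst : 4 * (a⁻¹ * a ^ ((κ : ℤ) - 1)) / (a⁻¹ + a ^ ((κ : ℤ) - 1)) ^ 2 =
        4 * a ^ κ / (1 + a ^ κ) ^ 2 := by
      rw [zpow_sub_one₀ ha0.ne', zpow_natCast]
      field_simp
    have h2 : a ^ (-j) • (M⁻¹ ξ) - c = a ^ (-j) • (M⁻¹ (ξ - a ^ j • M c)) := by
      rw [map_sub, map_smul, smul_sub, smul_smul, ← zpow_add₀ ha0.ne', neg_add_cancel, zpow_zero,
        one_smul]
      congr 1
      exact (M.symm_apply_apply c).symm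
    rw [hconst, h2, norm_dilation ha0, norm_dilation ha0, mul_left_comm] at h1
    exact le_of_mul_le_mul_left h1 (zpow_pos ha0 _)
  · rintro g ⟨j, hj, M, hM, hg⟩ ξ hξ
    have h1 := (hmem hg hξ).2.2
    rw [mem_ball_zero_iff, not_lt, norm_dilation ha0, zpow_neg, ← div_eq_inv_mul,
      le_div_iff₀ (zpow_pos ha0 j), ← zpow_neg_one, ← zpow_add₀ ha0.ne'] at h1
    -- Here `‖ξ‖ ≥ a^(j-1)`, and `j > -J` means `j - 1 ≥ -J`.
    exact (zpow_le_zpow_right₀ ha.le (by omega)).trans h1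

/-! ### Decay rates -/

theorem isBigOSeq_of_le {W : ℕ → ℝ≥0∞} {E : ℕ → ℝ} {K : ℝ} {S : ℝ≥0∞} (hK : 0 ≤ K) (hS : S ≠ ⊤)
    (hE : ∀ N, 0 ≤ E N) (N₀ : ℕ) (h : ∀ N ≥ N₀, W N ≤ ENNReal.ofReal (K * E N) * S) :
    IsBigOSeq W E := by
  refine ⟨K * S.toReal + 1, by positivity, N₀, fun N hN => (h N hN).trans ?_⟩
  rw [← ENNReal.ofReal_toReal hS, ← ENNReal.ofReal_mul (mul_nonneg hK (hE N)),
    ENNReal.toReal_ofReal ENNReal.toReal_nonneg]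
  refine ENNReal.ofReal_le_ofReal ?_
  nlinarith [hE N]

/-- Replacing `α^n` by `α^(n+k)` costs only the constant `α^(-2k)`; this absorbs the layers lost in
`energy_succ_le` (`k = 1`) and `energy_add_two_le` (`k = 2`). -/
theorem variationSymbol_pow_le {α : ℝ} (hα : 0 < α) (hα1 : α < 1) (n k : ℕ) (r : ℝ) :
    variationSymbol (α ^ n) r ≤ 2 * Real.pi / (α ^ k) ^ 2 * min 1 ((α ^ (n + k) * r) ^ 2) := by
  have hk : (0 : ℝ) < (α ^ k) ^ 2 := by positivity
  rw [mul_min_of_nonneg _ _ (by positivity)]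
  refine le_min ((variationSymbol_le_two _ _).trans ?_) ((variationSymbol_le_sq _ _).trans_eq ?_)
  · rw [mul_one, le_div_iff₀ hk]
    have : (α ^ k) ^ 2 ≤ 1 := pow_le_one₀ (by positivity) (pow_le_one₀ hα.le hα1.le)
    nlinarith [Real.pi_gt_three]
  · rw [pow_add]
    field_simp

namespace IsContractiveBank

variable {Ψ : Set (L2 d)} {α δ : ℝ}

/-- Energy decay for frequency-weighted signals. -/
theorem isBigOSeq_of_fourierWeighted (hΨ : IsContractiveBank Ψ α δ) (hδ : 0 < δ) (hα : 0 < α)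
    (hα1 : α < 1) {w : ℝ → ℝ} {E : ℕ → ℝ} (hE : ∀ N, 0 ≤ E N) {K : ℝ} (hK : 0 ≤ K) (N₀ : ℕ)
    (hw : ∀ N ≥ N₀, ∀ r : ℝ, 0 ≤ r → min 1 ((α ^ N * r) ^ 2) ≤ K * E N * w r ^ 2)
    {f : L2 d} (hf : f ∈ fourierWeighted w) :
    IsBigOSeq (fun N => energy Ψ N f) E := by
  have hC : 0 < (variationSymbol 1 δ)⁻¹ :=
    inv_pos.2 (variationSymbol_pos (by simpa using hδ.ne'))
  set L : ℝ := 2 * Real.pi / (α ^ 1) ^ 2 with hL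
  have hL0 : 0 < L := by positivity
  set S : ℝ≥0∞ := ∫⁻ ξ, ‖(w ‖ξ‖ : ℂ) * (𝓕 f : L2 d) ξ‖ₑ ^ 2 with hS
  have hSt : S ≠ ⊤ := by
    rw [hS, ← eLpNorm_two_sq]
    exact ENNReal.pow_ne_top (MemLp.eLpNorm_ne_top hf)
  refine isBigOSeq_of_le (K := (variationSymbol 1 δ)⁻¹ * (L * K)) (by positivity) hSt hE
    (N₀ + 1) fun N hN => ?_
  obtain ⟨n, rfl⟩ : ∃ n, N = n + 1 := ⟨N - 1, by omega⟩
  refine (hΨ.energy_succ_le hδ hα.le n f).trans ?_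
  rw [mul_assoc, ENNReal.ofReal_mul hC.le, mul_assoc, variation_eq_lintegral]
  gcongr
  rw [hS, ← lintegral_const_mul' _ _ ENNReal.ofReal_ne_top]
  refine lintegral_mono fun ξ => ?_
  rw [enorm_mul, mul_pow, ← mul_assoc, mul_comm]
  gcongr
  rw [← ofReal_norm, ← ENNReal.ofReal_pow (norm_nonneg _), Complex.norm_real, Real.norm_eq_abs,
    sq_abs, ← ENNReal.ofReal_mul (mul_nonneg (by positivity) (hE _))]
  refine ENNReal.ofReal_le_ofReal ?_
  calc variationSymbol (α ^ n) ‖ξ‖ ≤ L * min 1 ((α ^ (n + 1) * ‖ξ‖) ^ 2) :=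
        variationSymbol_pow_le hα hα1 n 1 _
    _ ≤ L * (K * E (n + 1) * w ‖ξ‖ ^ 2) := by
        gcongr
        exact hw _ (by omega) _ (norm_nonneg _)
    _ = _ := by ring

/-- Energy decay for signals in a decomposition space. -/
theorem isBigOSeq_of_decompSpace (hΨ : IsContractiveBank Ψ α δ) (hδ : 0 < δ) (hα : 0 < α)
    (hα1 : α < 1) {w : ℝ → ℝ} {E : ℕ → ℝ} (hE : ∀ N, 0 ≤ E N) {K : ℝ} (hK : 0 ≤ K) (N₀ : ℕ)
    (hw : ∀ N ≥ N₀, ∀ r : ℝ, 0 ≤ r → min 1 ((α ^ N * r) ^ 2) ≤ K * E N * w r ^ 2)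
    {f : L2 d} (hf : f ∈ decompSpace w Ψ) :
    IsBigOSeq (fun N => energy Ψ N f) E := by
  have hC : 0 < (variationSymbol 1 δ)⁻¹ :=
    inv_pos.2 (variationSymbol_pos (by simpa using hδ.ne'))
  set L : ℝ := 2 * Real.pi / (α ^ 2) ^ 2 with hL
  have hL0 : 0 < L := by positivity
  refine isBigOSeq_of_le (K := (variationSymbol 1 δ)⁻¹ * (L * K)) (by positivity)
    (ne_of_lt hf) hE (N₀ + 2) fun N hN => ?_
  obtain ⟨n, rfl⟩ : ∃ n, N = n + 2 := ⟨N - 2, by omega⟩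
  refine (hΨ.energy_add_two_le hδ hα.le n f).trans ?_
  rw [mul_assoc, ENNReal.ofReal_mul hC.le, mul_assoc]
  refine mul_le_mul' le_rfl ?_
  rw [← ENNReal.tsum_mul_left]
  refine ENNReal.tsum_le_tsum fun g => ?_
  refine (variation_propStep_le_freqRadius (by positivity) f (hΨ.integrable g g.2)
    (Lp.memLp (g : L2 d)) (hΨ.compact g g.2)).trans ?_
  rw [← mul_assoc]
  gcongr
  rw [← ENNReal.ofReal_mul (mul_nonneg (by positivity) (hE _))]
  refine ENNReal.ofReal_le_ofReal ?_
  set r := freqRadius ((g : L2 d) : Rd d → ℂ) with hr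
  calc variationSymbol (α ^ n) r ≤ L * min 1 ((α ^ (n + 2) * r) ^ 2) :=
        variationSymbol_pow_le hα hα1 n 2 _
    _ ≤ L * (K * E (n + 2) * w r ^ 2) := by
        gcongr
        exact hw _ (by omega) _ (freqRadius_nonneg _)
    _ = _ := by ring

end IsContractiveBank

/-- Applied with `R = α^(-N)`. Monotonicity of `ω` handles `r ≥ R`, monotonicity of `h(t) = t²
ω(t)⁻²` handles `T ≤ r ≤ R`, and boundedness of `h` near zero handles `r < T`. -/
theorem IsWeaklyDominated.exists_min_le {ω : ℝ → ℝ} (hω : IsWeaklyDominated 2 ω) :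
    ∃ K : ℝ, 0 ≤ K ∧ ∃ R₀ : ℝ, 0 < R₀ ∧ ∀ R ≥ R₀, ∀ r : ℝ, 0 ≤ r →
      min 1 ((R⁻¹ * r) ^ 2) ≤ K * ω R ^ (-2 : ℤ) * ω r ^ 2 := by
  obtain ⟨hpos, hmono, T, hT, ⟨B, hB⟩, hincr, htend⟩ := hω
  obtain ⟨R₁, hR₁⟩ := (htend.eventually_ge_atTop 1).exists_forall_of_atTop
  refine ⟨max 1 B, by positivity, max T R₁, lt_max_of_lt_left hT, fun R hR r hr => ?_⟩
  have hTR : T ≤ R := (le_max_left _ _).trans hR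
  have hR0 : 0 < R := hT.trans_le hTR
  have hωR : 0 < ω R := hpos R hR0
  have hRh := hR₁ R ((le_max_right _ _).trans hR)
  simp only [Real.rpow_two] at hB hincr hRh
  have hm1 : (1 : ℝ) ≤ max 1 B := le_max_left _ _
  have key : ∀ x : ℝ, ω r ^ 2 / ω R ^ 2 ≥ x → 0 ≤ x →
      x ≤ max 1 B * ω R ^ (-2 : ℤ) * ω r ^ 2 := by
    intro x hx hx0
    rw [zpow_neg, mul_assoc, ← div_eq_inv_mul]
    exact hx.le.trans (le_mul_of_one_le_left (by positivity) hm1)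
  -- The value `ω 0` is unconstrained, but `r = 0` does occur: it is the radius of a filter with
  -- zero transform.
  rcases hr.eq_or_lt with rfl | hr0
  · refine (min_le_right _ _).trans ?_
    rw [mul_zero, zero_pow two_ne_zero]
    positivity
  have hωr : 0 < ω r := hpos r hr0
  rcases le_total R r with h | h
  · refine (min_le_left _ _).trans (key 1 ?_ zero_le_one)
    rw [ge_iff_le, one_le_div (by positivity)]
    have := hmono (mem_Ioi.2 hR0) (mem_Ioi.2 hr0) h
    gcongr
  refine (min_le_right _ _).trans ?_
  rcases le_or_gt T r with h' | h'
  · refine key _ ?_ (by positivity)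
    have := hincr (mem_Ici.2 h') (mem_Ici.2 hTR) h
    simp only [zpow_neg, ← div_eq_mul_inv] at this
    rw [ge_iff_le, mul_pow, inv_pow, inv_mul_eq_div, div_le_div_iff₀ (by positivity) (by positivity)]
    have := (div_le_div_iff₀ (by positivity) (by positivity)).1 this
    norm_cast at this
    linarith
  -- Multiply `r² ≤ B ω(r)²` by `R⁻² ≤ ω(R)⁻²`, the latter being `h(R) ≥ 1`.
  · have h1 := hB r ⟨hr0, h'⟩
    rw [zpow_neg, ← div_eq_mul_inv, div_le_iff₀ (by positivity)] at h1
    rw [zpow_neg, ← div_eq_mul_inv, le_div_iff₀ (by positivity)] at hRh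
    norm_cast at h1 hRh
    rw [zpow_neg, mul_pow, inv_pow, inv_mul_eq_div, ← div_eq_mul_inv, div_mul_eq_mul_div,
      div_le_div_iff₀ (by positivity) (by positivity)]
    norm_cast
    have h2 : r ^ 2 ≤ max 1 B * ω r ^ 2 :=
      h1.trans (mul_le_mul_of_nonneg_right (le_max_right _ _) (by positivity))
    rw [one_mul] at hRh
    gcongr

/-- Interpolation: `min(1, y²) ≤ y^(2m)` for `0 < m ≤ 1`. The cap `m = min s 1` reflects the
quadratic behavior of the symbol at zero. -/
theorem min_le_sobolev {x r s : ℝ} (hx : 0 < x) (hr : 0 ≤ r) (hs : 0 < s) :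
    min 1 ((x * r) ^ 2) ≤ x ^ (2 * min s 1) * ((1 + r ^ 2) ^ (s / 2)) ^ 2 := by
  have hm0 : 0 < min s 1 := lt_min hs one_pos
  have hm1 : min s 1 ≤ 1 := min_le_right _ _
  have h0 : 0 ≤ x * r := by positivity
  have h1 : min 1 ((x * r) ^ 2) ≤ (x * r) ^ (2 * min s 1) := by
    rw [Real.rpow_mul h0, Real.rpow_two]
    rcases le_total 1 ((x * r) ^ 2) with h | h
    · exact (min_le_left _ _).trans (Real.one_le_rpow h hm0.le)
    · refine (min_le_right _ _).trans ?_
      rcases (sq_nonneg (x * r)).eq_or_lt with h' | h'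
      · rw [← h']; positivity
      · exact Real.self_le_rpow_of_le_one h'.le h hm1
  refine h1.trans ?_
  rw [Real.mul_rpow hx.le hr]
  gcongr
  rw [← Real.rpow_natCast, ← Real.rpow_mul (by positivity), Real.rpow_mul hr, Real.rpow_two]
  calc (r ^ 2) ^ min s 1 ≤ (1 + r ^ 2) ^ min s 1 := by gcongr; linarith
    _ ≤ (1 + r ^ 2) ^ (s / 2 * (2 : ℕ)) := by
      refine Real.rpow_le_rpow_of_exponent_le (by nlinarith [sq_nonneg r]) ?_
      push_cast
      linarith [min_le_left s 1]

theorem exists_min_le_logSobolev {α s : ℝ} (hα : 0 < α) (hα1 : α < 1) (hs : 0 < s) :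
    ∃ K : ℝ, 0 ≤ K ∧ ∀ N : ℕ, 1 ≤ N → ∀ r : ℝ, 0 ≤ r →
      min 1 ((α ^ N * r) ^ 2) ≤
        K * (N : ℝ) ^ (-2 * s) * (Real.log (Real.exp 1 + r) ^ s) ^ 2 := by
  -- So `α = e^(-2b)`, and the frequencies are split at `r = e^(bN)`. Below it `(α^N r)² ≤ e^(-2bN)`
  -- beats every power of `N`; above it `ln(e + r) ≥ bN`.
  set b : ℝ := -Real.log α / 2 with hb
  have hb0 : 0 < b := by
    have := Real.log_neg hα hα1
    rw [hb]; linarith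
  have hαN : ∀ N : ℕ, α ^ N = Real.exp (-(2 * (b * N))) := by
    intro N
    rw [hb, ← Real.rpow_natCast, Real.rpow_def_of_pos hα]
    congr 1; ring
  have hexp : ∀ x : ℝ, 0 < x → Real.exp (-x) ≤ (2 * s) ^ (2 * s) * x ^ (-(2 * s)) := by
    intro x hx
    -- This is `y ≤ e^y` at `y = x/(2s)`, raised to the power `2s`.
    have h1 : (x / (2 * s)) ^ (2 * s) ≤ Real.exp x := by
      calc (x / (2 * s)) ^ (2 * s) ≤ Real.exp (x / (2 * s)) ^ (2 * s) := by
            gcongr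
            linarith [Real.add_one_le_exp (x / (2 * s))]
        _ = Real.exp x := by
            rw [← Real.exp_mul]
            congr 1
            field_simp
    rw [Real.div_rpow hx.le (by positivity), div_le_iff₀ (by positivity)] at h1
    rw [Real.exp_neg, Real.rpow_neg hx.le, ← div_eq_mul_inv, inv_eq_one_div,
      div_le_div_iff₀ (Real.exp_pos x) (by positivity)]
    linarith
  refine ⟨(2 * s) ^ (2 * s) * (2 * b) ^ (-(2 * s)) + b ^ (-(2 * s)), by positivity,
    fun N hN r hr => ?_⟩
  have hN0 : (0 : ℝ) < N := by exact_mod_cast hN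
  set l := Real.log (Real.exp 1 + r) with hl
  have hl1 : 1 ≤ l := by
    rw [hl, Real.le_log_iff_exp_le (by positivity)]
    linarith
  have hsq : (l ^ s) ^ 2 = l ^ (2 * s) := by
    rw [← Real.rpow_natCast, ← Real.rpow_mul (by positivity)]
    congr 1
    push_cast
    ring
  rw [hsq, neg_mul, add_mul, add_mul]
  rcases le_total r (Real.exp (b * N)) with h | h
  · refine (min_le_right _ _).trans ?_
    have h1 : (α ^ N * r) ^ 2 ≤ Real.exp (-(2 * b * N)) := by
      calc (α ^ N * r) ^ 2 ≤ (α ^ N * Real.exp (b * N)) ^ 2 := by gcongr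
        _ = Real.exp (-(2 * b * N)) := by
            rw [hαN, ← Real.exp_add, ← Real.exp_nat_mul]
            congr 1
            push_cast
            ring
    have h2 := hexp (2 * b * N) (by positivity)
    rw [Real.mul_rpow (by positivity) hN0.le, ← mul_assoc] at h2
    have h3 : 1 ≤ l ^ (2 * s) := Real.one_le_rpow hl1 (by positivity)
    have h4 := le_mul_of_one_le_right
      (show 0 ≤ (2 * s) ^ (2 * s) * (2 * b) ^ (-(2 * s)) * (N : ℝ) ^ (-(2 * s)) by positivity) h3
    have h5 : 0 ≤ b ^ (-(2 * s)) * (N : ℝ) ^ (-(2 * s)) * l ^ (2 * s) := by positivity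
    linarith
  · refine (min_le_left _ _).trans ?_
    have h1 : b * N ≤ l := by
      rw [hl, Real.le_log_iff_exp_le (by positivity)]
      linarith [Real.exp_pos 1]
    have h2 : (b * N) ^ (2 * s) ≤ l ^ (2 * s) := by gcongr
    have h3 : b ^ (-(2 * s)) * (N : ℝ) ^ (-(2 * s)) * (b * N) ^ (2 * s) = 1 := by
      rw [← Real.mul_rpow hb0.le hN0.le, ← Real.rpow_add (by positivity), neg_add_cancel,
        Real.rpow_zero]
    have h4 := mul_le_mul_of_nonneg_left h2
      (show 0 ≤ b ^ (-(2 * s)) * (N : ℝ) ^ (-(2 * s)) by positivity)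
    have h5 : 0 ≤ (2 * s) ^ (2 * s) * (2 * b) ^ (-(2 * s)) * (N : ℝ) ^ (-(2 * s)) *
        l ^ (2 * s) := by positivity
    linarith

/-- With `q = a^κ > 1`, positivity is strict AM-GM, `4q < (1 + q)²`; the bound below `1` uses `ρ <
1`. -/
theorem contraction_factor_mem_Ioo {a ρ : ℝ} (ha : 1 < a) (hρ₀ : 0 ≤ ρ) (hρ₁ : ρ < 1) {κ : ℕ}
    (hκ : κ ≠ 0) :
    √(1 - 4 * a ^ κ / (1 + a ^ κ) ^ 2 * (1 - ρ) ^ 2) ∈ Ioo (0 : ℝ) 1 := by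
  have hq : 1 < a ^ κ := one_lt_pow₀ ha hκ
  set q := a ^ κ
  have h1 : 4 * q / (1 + q) ^ 2 < 1 := by
    rw [div_lt_one (by positivity)]
    nlinarith [sq_pos_of_pos (sub_pos.2 hq)]
  have h0 : 0 < 4 * q / (1 + q) ^ 2 := by positivity
  have h2 : 0 < (1 - ρ) ^ 2 := by have := sub_pos.2 hρ₁; positivity
  have h3 : (1 - ρ) ^ 2 ≤ 1 := pow_le_one₀ (by linarith) (by linarith)
  constructor
  · rw [Real.sqrt_pos, sub_pos]
    exact (mul_le_of_le_one_right h0.le h3).trans_lt h1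
  · rw [Real.sqrt_lt' one_pos]
    linarith [mul_pos h0 h2]

end Scattering

end

theorem mainTheorem8 {d : ℕ} (hd : 1 ≤ d)
    (a : ℝ) (ha : 1 < a)
    (G : Subgroup (Scattering.Od d)) (hGfin : Finite G)
    (hGneg : LinearIsometryEquiv.neg ℝ ∈ G)
    (J : ℤ) (ψ φ : Scattering.Rd d → ℂ)
    (hadm : Scattering.IsAdmissible a G ψ φ)
    (A : Scattering.Od d) (ρ : ℝ) (hρ₀ : 0 ≤ ρ) (hρ₁ : ρ < 1)
    (κ : ℕ) (hκ : 2 ≤ κ)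
    (hsupp : tsupport (𝓕 ψ) ⊆
      (A '' Scattering.cone d ρ) ∩ Scattering.shell d a⁻¹ (a ^ ((κ : ℤ) - 1)))
    (α : ℝ) (hα : α = √(1 - 4 * a ^ κ / (1 + a ^ κ) ^ 2 * (1 - ρ) ^ 2)) :
    (0 < α ∧ α < 1) ∧
    (∀ ω : ℝ → ℝ, Scattering.IsWeaklyDominated 2 ω →
      ∀ f ∈ Scattering.decompSpace ω (Scattering.wav ψ a G J),
        Scattering.IsBigOSeq (fun N => Scattering.energy (Scattering.wav ψ a G J) N f)
          (fun N => (ω (α ^ (-(N : ℤ)))) ^ (-2 : ℤ))) ∧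
    (∀ s : ℝ, 0 < s → ∀ f ∈ Scattering.sobolev d s,
      Scattering.IsBigOSeq (fun N => Scattering.energy (Scattering.wav ψ a G J) N f)
        (fun N => α ^ (2 * min s 1 * (N : ℝ)))) ∧
    (∀ s : ℝ, 0 < s → ∀ f ∈ Scattering.logSobolev d s,
      Scattering.IsBigOSeq (fun N => Scattering.energy (Scattering.wav ψ a G J) N f)
        (fun N => (N : ℝ) ^ (-2 * s))) := by

  have ha0 : 0 < a := by linarith
  have hbank := Scattering.isContractiveBank_wav hd ha J hadm A hρ₁ hsupp
  have hα01 := Scattering.contraction_factor_mem_Ioo ha hρ₀ hρ₁ (κ := κ) (by omega)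
  rw [← hα] at hbank hα01
  obtain ⟨hα0, hα1⟩ := hα01
  have hδ : 0 < a ^ (-J) := zpow_pos ha0 _
  have hN0 : ∀ N : ℕ, (0 : ℝ) < α ^ (-(N : ℤ)) := fun N => zpow_pos hα0 _
  refine ⟨⟨hα0, hα1⟩, fun ω hω f hf => ?_, fun s hs f hf => ?_, fun s hs f hf => ?_⟩
  · obtain ⟨K, hK, R₀, -, hR⟩ := hω.exists_min_le
    have htend : Tendsto (fun N : ℕ => α ^ (-(N : ℤ))) atTop atTop := by
      simpa using tendsto_pow_atTop_atTop_of_one_lt ((one_lt_inv₀ hα0).2 hα1)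
    obtain ⟨N₀, hN₀⟩ := (htend.eventually_ge_atTop R₀).exists_forall_of_atTop
    refine hbank.isBigOSeq_of_decompSpace hδ hα0 hα1 (w := ω)
      (fun N => zpow_nonneg (hω.1 _ (hN0 N)).le _) hK N₀ (fun N hN r hr => ?_) hf
    simpa using hR _ (hN₀ N hN) r hr
  · refine hbank.isBigOSeq_of_fourierWeighted hδ hα0 hα1 (fun N => by positivity) zero_le_one 0
      (fun N _ r hr => ?_) hf
    have heq : (α ^ N) ^ (2 * min s 1) = α ^ (2 * min s 1 * (N : ℝ)) := by
      rw [mul_comm (2 * min s 1), Real.rpow_mul hα0.le, Real.rpow_natCast]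
    rw [one_mul, ← heq]
    exact Scattering.min_le_sobolev (pow_pos hα0 N) hr hs
  · obtain ⟨K, hK, h⟩ := Scattering.exists_min_le_logSobolev hα0 hα1 hs
    -- The rate is claimed from `N = 1` on, since `0 ^ (-2 * s)` evaluates to `0`.
    exact hbank.isBigOSeq_of_fourierWeighted hδ hα0 hα1 (fun N => by positivity) hK 1
      (fun N hN r hr => h N hN r hr) hf
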